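/- For a finite simple graph $G$ with $n$ vertices, let $X_G=\{x_v : v\in V(G)\}$ be indeterminates indexed by its vertices and let $L(G,X)$ be its generalized Laplacian matrix over $\mathbb{Z}[X_G]$, with $L(G,X)_{u,u}=x_u$ and, for $u\neq v$, $L(G,X)_{u,v}=-1$ if $uv$ is an edge of $G$ and $L(G,X)_{u,v}=0$ otherwise. For $1\le j\le n$, the $j$-th critical ideal $I_j(G,X)\subseteq\mathbb{Z}[X_G]$ is the ideal generated by all $j\times j$ minors of $L(G,X)$; it is trivial if it equals $\mathbb{Z}[X_G]$. A $2$-matching of $G$ is a set of edges of $G$ such that every vertex of $G$ is incident to at most two of them, and $\nu_2(G)$ denotes the maximum number of edges of a $2$-matching of $G$. A leaf is a vertex of degree one. For $d\ge 3$ and $h\geq 1$, let $T(d,h)$ be the $d$-regular tree of depth $h$, that is, the rooted tree in which the root has $d$ children, every vertex at depth $1,\dots,h-1$ has $d-1$ children, and the vertices at depth $h$ have none. Let $T'(d,h)$ be the tree obtained from $T(d,h)$ by deleting one of its principal branches, that is, the rooted tree of depth $h$ in which every vertex at depth less than $h$ (the root included) has $d-1$ children. For $h\geq 3$, let $T_r(d,h-2)$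 and $T'_r(d,h-2)$ be the copies of $T(d,h-2)$ in $T(d,h)$ and of $T'(d,h-2)$ in $T'(d,h)$ that have the same root $r$ as the ambient tree, that is, the subtrees induced by the vertices at depth at most $h-2$. Let $h\geq 3$ and $d\geq 4$. (1) Put $k=\nu_2(T'(d,h))+1$ and $k'=\nu_2(T'(d,h-2))+1$. Then $I_k(T'(d,h),X)$ is the first nontrivial critical ideal of $T'(d,h)$ (that is, $k$ is at most the number of vertices, $I_j(T'(d,h),X)$ is trivial for $1\le j<k$, and $I_k(T'(d,h),X)$ is not), and, as ideals of $\mathbb{Z}[X_{T'(d,h)}]$, $$I_k(T'(d,h),X)=\left\langle \{x_v : v \text{ is a leaf of } T'(d,h)\},\ I_{k'}(T'_r(d,h-2),X)\right\rangle .$$ (2) Put $k=\nu_2(T(d,h))+1$ and $k'=\nu_2(T(d,h-2))+1$. Then $I_k(T(d,h),X)$ is the first nontrivial critical ideal of $T(d,h)$, and, as ideals of $\mathbb{Z}[X_{T(d,h)}]$, $$I_k(T(d,h),X)=\left\langle \{x_v : v \text{ is a leaf of } T(d,h)\},\ I_{k'}(T_r(d,h-2),X)\right\rangle .$$ -/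

import Mathlib

/-- The generalized Laplacian matrix `L(G, X)` of a simple graph `G`: the indeterminate `x_u` at the
diagonal position `(u, u)`, and minus the number of edges between `u` and `v` off the diagonal. -/
noncomputable def genLaplacian {V : Type*} (G : SimpleGraph V) :
    Matrix V V (MvPolynomial V ℤ) :=
  open Classical in
  Matrix.of fun u v => if u = v then MvPolynomial.X u else if G.Adj u v then -1 else 0

/-- The `j`-th critical ideal `I_j(G, X)`: the ideal of `ℤ[X_G]` generated by the `j`-minors of the
generalized Laplacian matrix, i.e. the determinants of its `j × j` submatrices with `j` distinct
rows and `j` distinct columns (reordering these only changes signs). -/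
noncomputable def criticalIdeal {V : Type*} (G : SimpleGraph V) (j : ℕ) :
    Ideal (MvPolynomial V ℤ) :=
  Ideal.span {p | ∃ r c : Fin j ↪ V, p = ((genLaplacian G).submatrix r c).det}

/-- `M` is a 2-matching of `G`: a set of edges of `G` such that every vertex is incident to at most
two of them. -/
def IsTwoMatching {V : Type*} (G : SimpleGraph V) (M : Finset (Sym2 V)) : Prop :=
  (∀ e ∈ M, e ∈ G.edgeSet) ∧ ∀ v : V, {e | e ∈ M ∧ v ∈ e}.ncard ≤ 2

/-- The 2-matching number `ν₂(G)`: the maximum number of edges of a 2-matching of `G`. -/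
noncomputable def twoMatchingNumber {V : Type*} [Fintype V] (G : SimpleGraph V) : ℕ :=
  open Classical in
  (Finset.univ.filter fun M : Finset (Sym2 V) => IsTwoMatching G M).sup Finset.card

/-- `v` is a leaf of `G`: it has exactly one neighbour. -/
def IsLeaf {V : Type*} (G : SimpleGraph V) (v : V) : Prop :=
  (G.neighborSet v).ncard = 1

/-- Vertices of the rooted tree of depth `h` in which each vertex at depth `i < h` has `b i`
children: words `w₀ w₁ … w_{i-1}` of length `i ≤ h` with `w_j ∈ {0, …, b j - 1}`. The root is the
empty word, and the first component is the depth. -/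
abbrev TreeVertex (b : ℕ → ℕ) (h : ℕ) : Type :=
  Σ i : Fin (h + 1), ((j : Fin (i : ℕ)) → Fin (b j))

/-- `u` is a child of `v`: the word `u` is `v` followed by one more letter. -/
def IsChild {b : ℕ → ℕ} {h : ℕ} (v u : TreeVertex b h) : Prop :=
  ∃ hl : (u.1 : ℕ) = (v.1 : ℕ) + 1,
    ∀ j : Fin (v.1 : ℕ), u.2 ⟨(j : ℕ), by omega⟩ = v.2 j

/-- The rooted tree of depth `h` in which each vertex at depth `i < h` has `b i` children, as a
simple graph: each vertex is joined to its children. -/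
def branchingTree (b : ℕ → ℕ) (h : ℕ) : SimpleGraph (TreeVertex b h) where
  Adj u v := IsChild u v ∨ IsChild v u
  symm := ⟨fun _ _ huv => huv.symm⟩
  loopless := ⟨fun u hu => by
    rcases hu with ⟨hl, _⟩ | ⟨hl, _⟩ <;> omega⟩

/-- The copy, with the same root, of the tree of depth `m` inside the tree of depth `h ≥ m`, as an
embedding onto the induced subgraph on the vertices of depth at most `m`. -/
def rootedCopy (b : ℕ → ℕ) {m h : ℕ} (hm : m ≤ h) :
    branchingTree b m ↪g branchingTree b h where
  toFun v := ⟨Fin.castLE (Nat.succ_le_succ hm) v.1, v.2⟩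
  inj' := by
    rintro ⟨i, v⟩ ⟨j, w⟩ hvw
    have hij : i = j := by
      have := congrArg (fun z : TreeVertex b h => (z.1 : ℕ)) hvw
      exact Fin.ext this
    subst hij
    simpa using hvw
  map_rel_iff' := Iff.rfl

/-- Numbers of children in the `d`-regular tree: `d` at the root, `d - 1` elsewhere, so that every
vertex other than a leaf has degree `d`. -/
def regularBranching (d : ℕ) (i : ℕ) : ℕ :=
  if i = 0 then d else d - 1

/-- The `d`-regular tree `T(d, h)` of depth `h`. -/
abbrev regularTree (d h : ℕ) : SimpleGraph (TreeVertex (regularBranching d) h) :=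
  branchingTree (regularBranching d) h

/-- The tree `T'(d, h)` obtained from `T(d, h)` by deleting one of its principal branches: the tree
of depth `h` in which the root too has only `d - 1` children. -/
abbrev prunedTree (d h : ℕ) : SimpleGraph (TreeVertex (fun _ => d - 1) h) :=
  branchingTree (fun _ => d - 1) h

/-!
Let `T` be a rooted tree of depth `h ≥ 2` in which every vertex of depth less than `h` has at least
three children. It is obtained from its copy `T₂` of depth `h - 2` by adding the set `S` of vertices
of depth `h - 1` and the set `L` of leaves, the latter pendant at the former
(`IsStarExtension`). Both trees of the theorem are of this form, since `d - 1 ≥ 3`.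

* A 2-matching has at most two edges at each vertex of `S`, its other edges lie in `T₂`, and two
  pendant edges at each vertex of `S` can always be added, so `ν₂(T) = ν₂(T₂) + 2 |S|`
  (`IsStarExtension.twoMatchingNumber_eq`).
* After the leaf variables are set to zero, the row and the column of a leaf have their only nonzero
  entry, `-1`, at its parent. Expanding minors along these rows and columns removes all stars, so
  modulo the leaf variables `I_{j + 2|S|}(T)` lies in the ideal generated by `I_j(T₂)`
  (`IsStarExtension.criticalIdeal_le`).
* Conversely, every minor of `T₂` can be bordered, up to sign with the same value, by two rows and
  two columns for each star (`IsStarExtension.map_criticalIdeal_le`). Since a star has at least three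
  leaves, there is room to border also by the row and the column of a leaf `l`, which multiplies the
  minor by `x_l`. If `I_j(T₂)` is trivial, this gives `x_l ∈ I_{j + 1 + 2|S|}(T)`
  (`IsStarExtension.X_mem_criticalIdeal`).

With `j = ν₂(T₂)` this is the formula for the ideals. By induction on the depth in steps of two, from
edgeless graphs, the critical ideal of index `ν₂` is trivial, and the next one consists of
polynomials without constant term, hence is not. The bookkeeping is done with the ideals
`minorIdeal M R C k` of `k`-minors with rows from `R` and columns from `C`, to which rows and columns
are added one at a time.
-/

/-! ### Ideals of minors with prescribed rows and columns -/

section MinorIdeal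

variable {m n A B : Type*} [CommRing A] [CommRing B]

/-- The ideal generated by the `k`-minors of `M` whose rows are taken from `R` and whose columns
are taken from `C`. Rows and columns may be repeated, which only adds zero minors. -/
def minorIdeal (M : Matrix m n A) (R : Set m) (C : Set n) (k : ℕ) : Ideal A :=
  Ideal.span {x | ∃ (r : Fin k → m) (c : Fin k → n),
    (∀ i, r i ∈ R) ∧ (∀ i, c i ∈ C) ∧ x = (M.submatrix r c).det}

lemma det_mem_minorIdeal {M : Matrix m n A} {R : Set m} {C : Set n} {k : ℕ} {r : Fin k → m}
    {c : Fin k → n} (hr : ∀ i, r i ∈ R) (hc : ∀ i, c i ∈ C) :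
    (M.submatrix r c).det ∈ minorIdeal M R C k :=
  Ideal.subset_span ⟨r, c, hr, hc, rfl⟩

/-- Minors with a repeated row or column vanish, so only injective choices have to be tested. -/
lemma minorIdeal_le {M : Matrix m n A} {R : Set m} {C : Set n} {k : ℕ} {I : Ideal A}
    (h : ∀ (r : Fin k → m) (c : Fin k → n), r.Injective → c.Injective → (∀ i, r i ∈ R) →
      (∀ i, c i ∈ C) → (M.submatrix r c).det ∈ I) : minorIdeal M R C k ≤ I := by
  refine Ideal.span_le.2 ?_
  rintro _ ⟨r, c, hr, hc, rfl⟩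
  by_cases hri : r.Injective
  · by_cases hci : c.Injective
    · exact h r c hri hci hr hc
    · obtain ⟨i, j, hij, hne⟩ := Function.not_injective_iff.1 hci
      rw [Matrix.det_zero_of_column_eq hne (fun k => by simp [hij])]
      exact I.zero_mem
  · obtain ⟨i, j, hij, hne⟩ := Function.not_injective_iff.1 hri
    rw [Matrix.det_zero_of_row_eq hne (by ext k; simp [hij])]
    exact I.zero_mem

lemma minorIdeal_mono (M : Matrix m n A) {R R' : Set m} {C C' : Set n} (k : ℕ) (hR : R ⊆ R')
    (hC : C ⊆ C') : minorIdeal M R C k ≤ minorIdeal M R' C' k :=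
  minorIdeal_le fun _ _ _ _ hr hc =>
    det_mem_minorIdeal (fun i => hR (hr i)) (fun i => hC (hc i))

lemma minorIdeal_transpose (M : Matrix m n A) (R : Set m) (C : Set n) (k : ℕ) :
    minorIdeal M.transpose C R k = minorIdeal M R C k := by
  apply le_antisymm <;> refine minorIdeal_le fun r c _ _ hr hc => ?_
  · rw [← Matrix.det_transpose]
    exact det_mem_minorIdeal hc hr
  · rw [← Matrix.det_transpose]
    exact det_mem_minorIdeal (M := M.transpose) hc hr

lemma map_minorIdeal (φ : A →+* B) (M : Matrix m n A) (R : Set m) (C : Set n) (k : ℕ) :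
    (minorIdeal M R C k).map φ = minorIdeal (M.map φ) R C k := by
  apply le_antisymm
  · refine Ideal.map_le_iff_le_comap.2 (minorIdeal_le fun r c _ _ hr hc => ?_)
    rw [Ideal.mem_comap, RingHom.map_det]
    exact det_mem_minorIdeal (M := M.map φ) hr hc
  · refine minorIdeal_le fun r c _ _ hr hc => ?_
    have := Ideal.mem_map_of_mem φ (det_mem_minorIdeal (M := M) hr hc)
    rwa [RingHom.map_det] at this

lemma minorIdeal_zero (M : Matrix m n A) (R : Set m) (C : Set n) : minorIdeal M R C 0 = ⊤ := by
  refine (Ideal.eq_top_iff_one _).2 ?_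
  have := det_mem_minorIdeal (M := M) (R := R) (C := C) (r := Fin.elim0) (c := Fin.elim0)
    (fun i => i.elim0) (fun i => i.elim0)
  simpa using this

lemma minorIdeal_succ_le (M : Matrix m n A) (R : Set m) (C : Set n) (k : ℕ) :
    minorIdeal M R C (k + 1) ≤ minorIdeal M R C k := by
  refine minorIdeal_le fun r c _ _ hr hc => ?_
  rw [Matrix.det_succ_row _ 0]
  refine Ideal.sum_mem _ fun j _ => Ideal.mul_mem_left _ _ ?_
  rw [Matrix.submatrix_submatrix]
  exact det_mem_minorIdeal (fun i => hr _) (fun i => hc _)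

lemma minorIdeal_antitone (M : Matrix m n A) (R : Set m) (C : Set n) :
    Antitone (minorIdeal M R C) :=
  antitone_nat_of_succ_le (minorIdeal_succ_le M R C)

/-- Bordering a minor by a row that vanishes on its columns multiplies it by the corner entry. -/
lemma mul_mem_minorIdeal_of_row {M : Matrix m n A} {R : Set m} {C : Set n} {k : ℕ} {r : m} (c : n)
    (h : ∀ c' ∈ C, M r c' = 0) {x : A} (hx : x ∈ minorIdeal M R C k) :
    M r c * x ∈ minorIdeal M (insert r R) (insert c C) (k + 1) := by
  suffices minorIdeal M R C k ≤
      (minorIdeal M (insert r R) (insert c C) (k + 1)).colon {M r c} by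
    have := Submodule.mem_colon_singleton.1 (this hx)
    rwa [smul_eq_mul, mul_comm] at this
  refine minorIdeal_le fun ρ γ _ _ hρ hγ => Submodule.mem_colon_singleton.2 ?_
  have hdet : (M.submatrix (Fin.cons r ρ : Fin (k + 1) → m) (Fin.cons c γ : Fin (k + 1) → n)).det
      = (M.submatrix ρ γ).det • M r c := by
    rw [Matrix.det_succ_row_zero, Fin.sum_univ_succ, Finset.sum_eq_zero]
    · simp [Matrix.submatrix_submatrix, Function.comp_def, mul_comm]
    · intro j _
      simp [h _ (hγ j)]
  rw [← hdet]
  refine det_mem_minorIdeal (fun i => ?_) (fun i => ?_)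
  · refine Fin.cases ?_ (fun i => ?_) i
    · simp
    · simpa using Or.inr (hρ i)
  · refine Fin.cases ?_ (fun i => ?_) i
    · simp
    · simpa using Or.inr (hγ i)

lemma mul_mem_minorIdeal_of_col {M : Matrix m n A} {R : Set m} {C : Set n} {k : ℕ} (r : m) {c : n}
    (h : ∀ r' ∈ R, M r' c = 0) {x : A} (hx : x ∈ minorIdeal M R C k) :
    M r c * x ∈ minorIdeal M (insert r R) (insert c C) (k + 1) := by
  rw [← minorIdeal_transpose] at hx ⊢
  exact mul_mem_minorIdeal_of_row (M := M.transpose) r h hx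

/-- Adding one row and one column to the matrix, the row vanishing on the old columns, and
increasing the size of the minors by one does not enlarge the ideal of minors. -/
lemma minorIdeal_insert_le_of_row {M : Matrix m n A} {R : Set m} {C : Set n} (k : ℕ) {r : m} (c : n)
    (h : ∀ c' ∈ C, M r c' = 0) :
    minorIdeal M (insert r R) (insert c C) (k + 1) ≤ minorIdeal M R C k := by
  refine minorIdeal_le fun ρ γ hρi hγi hρ hγ => ?_
  by_cases hr : ∃ i, ρ i = r
  · obtain ⟨i, hi⟩ := hr
    rw [Matrix.det_succ_row _ i]
    refine Ideal.sum_mem _ fun j _ => ?_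
    rw [Matrix.submatrix_apply, hi, Matrix.submatrix_submatrix]
    rcases hγ j with hj | hj
    · refine Ideal.mul_mem_left _ _ (det_mem_minorIdeal (fun a => ?_) (fun a => ?_))
      · exact (hρ _).resolve_left fun ha => Fin.succAbove_ne i a (hρi (ha.trans hi.symm))
      · exact (hγ _).resolve_left fun ha => Fin.succAbove_ne j a (hγi (ha.trans hj.symm))
    · rw [h _ hj, mul_zero, zero_mul]
      exact Ideal.zero_mem _
  · push Not at hr
    -- Expand along column `c`; if it does not occur, expand along any column.
    obtain ⟨j, hj⟩ : ∃ j : Fin (k + 1), ∀ a : Fin k, γ (j.succAbove a) ≠ c := by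
      by_cases hc : ∃ j, γ j = c
      · obtain ⟨j, hj⟩ := hc
        exact ⟨j, fun a ha => Fin.succAbove_ne j a (hγi (ha.trans hj.symm))⟩
      · push Not at hc
        exact ⟨0, fun a => hc _⟩
    rw [Matrix.det_succ_column _ j]
    refine Ideal.sum_mem _ fun i _ => Ideal.mul_mem_left _ _ ?_
    rw [Matrix.submatrix_submatrix]
    exact det_mem_minorIdeal (fun a => (hρ _).resolve_left (hr _))
      (fun a => (hγ _).resolve_left (hj a))

lemma minorIdeal_insert_le_of_col {M : Matrix m n A} {R : Set m} {C : Set n} (k : ℕ) (r : m) {c : n}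
    (h : ∀ r' ∈ R, M r' c = 0) :
    minorIdeal M (insert r R) (insert c C) (k + 1) ≤ minorIdeal M R C k := by
  rw [← minorIdeal_transpose, ← minorIdeal_transpose M R C]
  exact minorIdeal_insert_le_of_row (M := M.transpose) k r h

lemma minorIdeal_union_le_of_rows {M : Matrix m n A} {R K : Set m} {C : Set n} (k : ℕ)
    (h : ∀ r ∈ K, ∀ c ∈ C, M r c = 0) : minorIdeal M (R ∪ K) C k ≤ minorIdeal M R C k := by
  refine minorIdeal_le fun ρ γ _ _ hρ hγ => ?_
  by_cases hr : ∃ i, ρ i ∈ K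
  · obtain ⟨i, hi⟩ := hr
    rw [Matrix.det_eq_zero_of_row_eq_zero i fun j => h _ hi _ (hγ j)]
    exact Ideal.zero_mem _
  · push Not at hr
    exact det_mem_minorIdeal (fun a => (hρ a).resolve_right (hr a)) hγ

lemma minorIdeal_union_le_of_cols {M : Matrix m n A} {R : Set m} {C K : Set n} (k : ℕ)
    (h : ∀ c ∈ K, ∀ r ∈ R, M r c = 0) : minorIdeal M R (C ∪ K) k ≤ minorIdeal M R C k := by
  rw [← minorIdeal_transpose, ← minorIdeal_transpose M R C]
  exact minorIdeal_union_le_of_rows (M := M.transpose) k h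

end MinorIdeal

/-! ### Critical ideals of graphs -/

section CriticalIdeal

variable {V W : Type*}

lemma criticalIdeal_eq_minorIdeal (G : SimpleGraph V) (j : ℕ) :
    criticalIdeal G j = minorIdeal (genLaplacian G) Set.univ Set.univ j := by
  apply le_antisymm
  · refine Ideal.span_le.2 ?_
    rintro _ ⟨r, c, rfl⟩
    exact det_mem_minorIdeal (fun _ => trivial) (fun _ => trivial)
  · exact minorIdeal_le fun r c hr hc _ _ => Ideal.subset_span ⟨⟨r, hr⟩, ⟨c, hc⟩, rfl⟩

lemma criticalIdeal_antitone (G : SimpleGraph V) : Antitone (criticalIdeal G) := by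
  intro i j hij
  simp only [criticalIdeal_eq_minorIdeal]
  exact minorIdeal_antitone _ _ _ hij

lemma criticalIdeal_zero (G : SimpleGraph V) : criticalIdeal G 0 = ⊤ := by
  rw [criticalIdeal_eq_minorIdeal, minorIdeal_zero]

lemma genLaplacian_self (G : SimpleGraph V) (v : V) : genLaplacian G v v = MvPolynomial.X v := by
  simp [genLaplacian]

lemma genLaplacian_of_adj {G : SimpleGraph V} {u v : V} (h : G.Adj u v) :
    genLaplacian G u v = -1 := by
  simp [genLaplacian, h, h.ne]

lemma genLaplacian_of_not_adj {G : SimpleGraph V} {u v : V} (hne : u ≠ v) (h : ¬G.Adj u v) :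
    genLaplacian G u v = 0 := by
  simp [genLaplacian, h, hne]

lemma genLaplacian_embedding {H : SimpleGraph W} {G : SimpleGraph V} (f : H ↪g G) (u v : W) :
    genLaplacian G (f u) (f v) = MvPolynomial.rename f (genLaplacian H u v) := by
  by_cases huv : u = v
  · subst huv
    simp [genLaplacian_self]
  · have hf : f u ≠ f v := fun h => huv (f.injective h)
    by_cases h : H.Adj u v
    · rw [genLaplacian_of_adj h, genLaplacian_of_adj (f.map_adj_iff.2 h)]
      simp
    · rw [genLaplacian_of_not_adj huv h,
        genLaplacian_of_not_adj hf (fun h' => h (f.map_adj_iff.1 h'))]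
      simp

/-- The critical ideals of an induced subgraph are the ideals of minors of the submatrix of the
generalized Laplacian on its vertices. -/
lemma map_criticalIdeal_embedding {H : SimpleGraph W} {G : SimpleGraph V} (f : H ↪g G) (j : ℕ) :
    (criticalIdeal H j).map (MvPolynomial.rename f) =
      minorIdeal (genLaplacian G) (Set.range f) (Set.range f) j := by
  have key : ∀ r c : Fin j → W, MvPolynomial.rename f ((genLaplacian H).submatrix r c).det =
      ((genLaplacian G).submatrix (f ∘ r) (f ∘ c)).det := by
    intro r c
    rw [AlgHom.map_det]
    congr 1
    ext a b : 2
    simp [genLaplacian_embedding]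
  rw [criticalIdeal_eq_minorIdeal]
  apply le_antisymm
  · refine Ideal.map_le_iff_le_comap.2 (minorIdeal_le fun r c _ _ _ _ => ?_)
    rw [Ideal.mem_comap, key]
    exact det_mem_minorIdeal (fun _ => ⟨_, rfl⟩) (fun _ => ⟨_, rfl⟩)
  · refine minorIdeal_le fun r c _ _ hr hc => ?_
    choose r' hr' using hr
    choose c' hc' using hc
    obtain rfl : f ∘ r' = r := funext hr'
    obtain rfl : f ∘ c' = c := funext hc'
    rw [← key]
    exact Ideal.mem_map_of_mem _ (det_mem_minorIdeal (fun _ => trivial) (fun _ => trivial))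

end CriticalIdeal

/-! ### Attaching pendant stars -/

section PendantStars

variable {V W : Type*} {G : SimpleGraph V} {H : SimpleGraph W} {f : H ↪g G}
  {S : Finset V} {L : Set V} {p : V → V}

/-- `G` arises from its induced subgraph `f : H ↪g G` by adding the vertices of `S` (the centres)
and of `L`, where every `l ∈ L` is pendant at the centre `p l`, and every centre has at least three
pendant vertices. Edges between centres, and between centres and `H`, are arbitrary. -/
structure IsStarExtension (f : H ↪g G) (S : Finset V) (L : Set V) (p : V → V) : Prop where
  mem_range_iff : ∀ v, v ∈ Set.range f ↔ v ∉ S ∧ v ∉ L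
  notMem_of_mem : ∀ v ∈ S, v ∉ L
  parent_mem : ∀ l ∈ L, p l ∈ S
  adj_iff : ∀ l ∈ L, ∀ v, G.Adj l v ↔ v = p l
  exists_three : ∀ s ∈ S, ∃ g : Fin 3 ↪ V, ∀ i, g i ∈ L ∧ p (g i) = s

namespace IsStarExtension

lemma exists_pair_ne (h : IsStarExtension f S L p) (l : V) : ∃ a b : V → V, ∀ s ∈ S,
    (a s ∈ L ∧ p (a s) = s ∧ a s ≠ l) ∧ (b s ∈ L ∧ p (b s) = s ∧ b s ≠ l) ∧ a s ≠ b s := by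
  have key : ∀ s, ∃ x y : V, s ∈ S →
      (x ∈ L ∧ p x = s ∧ x ≠ l) ∧ (y ∈ L ∧ p y = s ∧ y ≠ l) ∧ x ≠ y := by
    intro s
    by_cases hs : s ∈ S
    · obtain ⟨g, hg⟩ := h.exists_three s hs
      have h01 : g 0 ≠ g 1 := g.injective.ne (by decide)
      have h02 : g 0 ≠ g 2 := g.injective.ne (by decide)
      have h12 : g 1 ≠ g 2 := g.injective.ne (by decide)
      by_cases h0 : g 0 = l
      · exact ⟨g 1, g 2, fun _ => ⟨⟨(hg 1).1, (hg 1).2, h0 ▸ h01.symm⟩,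
          ⟨(hg 2).1, (hg 2).2, h0 ▸ h02.symm⟩, h12⟩⟩
      · by_cases h1 : g 1 = l
        · exact ⟨g 0, g 2, fun _ => ⟨⟨(hg 0).1, (hg 0).2, h0⟩,
            ⟨(hg 2).1, (hg 2).2, h1 ▸ h12.symm⟩, h02⟩⟩
        · exact ⟨g 0, g 1, fun _ => ⟨⟨(hg 0).1, (hg 0).2, h0⟩, ⟨(hg 1).1, (hg 1).2, h1⟩, h01⟩⟩
    · exact ⟨s, s, fun h => absurd h hs⟩
  choose a b hab using key
  exact ⟨a, b, fun s hs => hab s hs⟩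

lemma exists_pair (h : IsStarExtension f S L p) : ∃ a b : V → V, ∀ s ∈ S,
    (a s ∈ L ∧ p (a s) = s) ∧ (b s ∈ L ∧ p (b s) = s) ∧ a s ≠ b s := by
  rcases S.eq_empty_or_nonempty with rfl | ⟨s, -⟩
  · exact ⟨id, id, by simp⟩
  · obtain ⟨a, b, hab⟩ := h.exists_pair_ne s
    exact ⟨a, b, fun s hs => ⟨⟨(hab s hs).1.1, (hab s hs).1.2.1⟩,
      ⟨(hab s hs).2.1.1, (hab s hs).2.1.2.1⟩, (hab s hs).2.2⟩⟩

lemma adj_symm_iff (h : IsStarExtension f S L p) {l : V} (hl : l ∈ L) (v : V) :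
    G.Adj v l ↔ v = p l := by
  rw [G.adj_comm, h.adj_iff l hl]

lemma row_eq_zero (h : IsStarExtension f S L p) {l v : V} (hl : l ∈ L) (hv : v ≠ l)
    (hp : v ≠ p l) : genLaplacian G l v = 0 :=
  genLaplacian_of_not_adj hv.symm (by rwa [h.adj_iff l hl])

lemma col_eq_zero (h : IsStarExtension f S L p) {l v : V} (hl : l ∈ L) (hv : v ≠ l)
    (hp : v ≠ p l) : genLaplacian G v l = 0 :=
  genLaplacian_of_not_adj hv (by rwa [h.adj_symm_iff hl])

/-- A choice of two pendant vertices `a s` and `b s` for each centre `s ∈ T` borders every minor by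
a block of determinant `± 1`, with rows `s, a s` and columns `b s, s`. -/
lemma minorIdeal_le_bordered (h : IsStarExtension f S L p) {a b : V → V}
    (hab : ∀ s ∈ S, (a s ∈ L ∧ p (a s) = s) ∧ (b s ∈ L ∧ p (b s) = s) ∧ a s ≠ b s)
    {R C : Set V} (hR : ∀ s ∈ S, s ∉ R ∧ b s ∉ R) (hC : ∀ s ∈ S, s ∉ C ∧ a s ∉ C) (j : ℕ)
    (T : Finset V) (hT : T ⊆ S) :
    minorIdeal (genLaplacian G) R C j ≤
      minorIdeal (genLaplacian G) (R ∪ T ∪ a '' T) (C ∪ T ∪ b '' T) (j + 2 * T.card) := by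
  classical
  induction T using Finset.induction_on with
  | empty => simp
  | insert s T hsT ih =>
    have hs : s ∈ S := hT (Finset.mem_insert_self s T)
    have hTS : T ⊆ S := (Finset.subset_insert s T).trans hT
    refine (ih hTS).trans ?_
    obtain ⟨⟨haL, hap⟩, ⟨hbL, hbp⟩, hne⟩ := hab s hs
    have hcol : ∀ v ∈ R ∪ T ∪ a '' T, genLaplacian G v (b s) = 0 := by
      rintro v ((hv | hv) | ⟨t, ht, rfl⟩)
      · exact h.col_eq_zero hbL (fun e => (hR s hs).2 (e ▸ hv))
          (fun e => (hR s hs).1 (by rw [e, hbp] at hv; exact hv))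
      · exact h.col_eq_zero hbL (fun e => h.notMem_of_mem v (hTS hv) (e ▸ hbL))
          (fun e => hsT (by rw [e, hbp] at hv; exact hv))
      · have htS := hab t (hTS ht)
        refine h.col_eq_zero hbL (fun e => hsT ?_) (fun e => ?_)
        · have : t = s := by rw [← htS.1.2, e, hbp]
          exact this ▸ ht
        · rw [hbp] at e
          exact h.notMem_of_mem s hs (e ▸ htS.1.1)
    have hrow : ∀ v ∈ insert (b s) (C ∪ T ∪ b '' T), genLaplacian G (a s) v = 0 := by
      rintro v (rfl | (hv | hv) | ⟨t, ht, rfl⟩)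
      · exact h.row_eq_zero haL hne.symm
          (fun e => h.notMem_of_mem s hs (by rw [hap] at e; exact e ▸ hbL))
      · exact h.row_eq_zero haL (fun e => (hC s hs).2 (e ▸ hv))
          (fun e => (hC s hs).1 (by rw [e, hap] at hv; exact hv))
      · exact h.row_eq_zero haL (fun e => h.notMem_of_mem v (hTS hv) (e ▸ haL))
          (fun e => hsT (by rw [e, hap] at hv; exact hv))
      · have htS := hab t (hTS ht)
        refine h.row_eq_zero haL (fun e => hsT ?_) (fun e => ?_)
        · have : t = s := by rw [← htS.2.1.2, e, hap]
          exact this ▸ ht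
        · rw [hap] at e
          exact h.notMem_of_mem s hs (e ▸ htS.2.1.1)
    intro x hx
    have h1 := mul_mem_minorIdeal_of_col s hcol hx
    have h2 := mul_mem_minorIdeal_of_row s hrow h1
    rw [genLaplacian_of_adj ((h.adj_symm_iff hbL s).2 hbp.symm),
      genLaplacian_of_adj ((h.adj_iff _ haL s).2 hap.symm), ← mul_assoc] at h2
    rw [Finset.card_insert_of_notMem hsT, mul_add, ← add_assoc]
    rw [neg_mul_neg, one_mul, one_mul] at h2
    refine minorIdeal_mono _ _ ?_ ?_ h2
    · rintro v (rfl | rfl | (hv | hv) | ⟨t, ht, rfl⟩)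
      · exact Or.inr ⟨s, by simp, rfl⟩
      · exact Or.inl (Or.inr (by simp))
      · exact Or.inl (Or.inl hv)
      · exact Or.inl (Or.inr (by simpa using Or.inr hv))
      · exact Or.inr ⟨t, by simpa using Or.inr ht, rfl⟩
    · rintro v (rfl | rfl | (hv | hv) | ⟨t, ht, rfl⟩)
      · exact Or.inl (Or.inr (by simp))
      · exact Or.inr ⟨s, by simp, rfl⟩
      · exact Or.inl (Or.inl hv)
      · exact Or.inl (Or.inr (by simpa using Or.inr hv))
      · exact Or.inr ⟨t, by simpa using Or.inr ht, rfl⟩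

lemma minorIdeal_le_criticalIdeal (h : IsStarExtension f S L p) {a b : V → V}
    (hab : ∀ s ∈ S, (a s ∈ L ∧ p (a s) = s) ∧ (b s ∈ L ∧ p (b s) = s) ∧ a s ≠ b s)
    {R C : Set V} (hR : ∀ s ∈ S, s ∉ R ∧ b s ∉ R) (hC : ∀ s ∈ S, s ∉ C ∧ a s ∉ C) (j : ℕ) :
    minorIdeal (genLaplacian G) R C j ≤ criticalIdeal G (j + 2 * S.card) := by
  rw [criticalIdeal_eq_minorIdeal]
  exact (h.minorIdeal_le_bordered hab hR hC j S subset_rfl).trans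
    (minorIdeal_mono _ _ (Set.subset_univ _) (Set.subset_univ _))

lemma map_criticalIdeal_le (h : IsStarExtension f S L p) (j : ℕ) :
    (criticalIdeal H j).map (MvPolynomial.rename f) ≤ criticalIdeal G (j + 2 * S.card) := by
  rw [map_criticalIdeal_embedding]
  obtain ⟨a, b, hab⟩ := h.exists_pair
  refine h.minorIdeal_le_criticalIdeal hab (fun s hs => ⟨?_, ?_⟩) (fun s hs => ⟨?_, ?_⟩) j
  · exact fun h' => ((h.mem_range_iff s).1 h').1 hs
  · exact fun h' => ((h.mem_range_iff _).1 h').2 (hab s hs).2.1.1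
  · exact fun h' => ((h.mem_range_iff s).1 h').1 hs
  · exact fun h' => ((h.mem_range_iff _).1 h').2 (hab s hs).1.1

/-- With `l` a third pendant vertex next to the two chosen at each centre, the minors of `H`
bordered first by row and column `l` are multiples of `x_l`. -/
lemma X_mem_criticalIdeal (h : IsStarExtension f S L p) {j : ℕ} (hj : criticalIdeal H j = ⊤)
    {l : V} (hl : l ∈ L) : MvPolynomial.X l ∈ criticalIdeal G (j + 1 + 2 * S.card) := by
  obtain ⟨a, b, hab⟩ := h.exists_pair_ne l
  have hS : ∀ s ∈ S, s ∉ insert l (Set.range f) := by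
    rintro s hs (rfl | hs')
    · exact h.notMem_of_mem s hs hl
    · exact ((h.mem_range_iff s).1 hs').1 hs
  have hL : ∀ v ∈ L, v ≠ l → v ∉ insert l (Set.range f) := by
    rintro v hv hne (rfl | hv')
    · exact hne rfl
    · exact ((h.mem_range_iff v).1 hv').2 hv
  refine h.minorIdeal_le_criticalIdeal (R := insert l (Set.range f)) (C := insert l (Set.range f))
    (a := a) (b := b)
    (fun s hs => ⟨⟨(hab s hs).1.1, (hab s hs).1.2.1⟩, ⟨(hab s hs).2.1.1, (hab s hs).2.1.2.1⟩,
      (hab s hs).2.2⟩) (fun s hs => ⟨hS s hs, hL _ (hab s hs).2.1.1 (hab s hs).2.1.2.2⟩)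
    (fun s hs => ⟨hS s hs, hL _ (hab s hs).1.1 (hab s hs).1.2.2⟩) (j + 1) ?_
  have h1 : (1 : MvPolynomial V ℤ) ∈
      minorIdeal (genLaplacian G) (Set.range f) (Set.range f) j := by
    rw [← map_criticalIdeal_embedding, hj, Ideal.map_top]
    trivial
  have hrow : ∀ v ∈ Set.range f, genLaplacian G l v = 0 := by
    intro v hv
    have hv' := (h.mem_range_iff v).1 hv
    exact h.row_eq_zero hl (fun e => hv'.2 (e ▸ hl)) (fun e => hv'.1 (e ▸ h.parent_mem l hl))
  have := mul_mem_minorIdeal_of_row l hrow h1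
  rwa [genLaplacian_self, mul_one] at this

/-- Let `M` be a matrix in which the rows and columns of the pendant vertices have their only
nonzero entry at the centre. Then the stars centred at `T` contribute at most `2 * T.card` to the
size of the minors. -/
lemma minorIdeal_le_of_pendant_zero {A : Type*} [CommRing A] (h : IsStarExtension f S L p)
    {M : Matrix V V A} (hrow : ∀ l ∈ L, ∀ v, v ≠ p l → M l v = 0)
    (hcol : ∀ l ∈ L, ∀ v, v ≠ p l → M v l = 0) (j : ℕ) (T : Finset V) (hT : T ⊆ S) :
    minorIdeal M (Set.range f ∪ T ∪ {l ∈ L | p l ∈ T}) (Set.range f ∪ T ∪ {l ∈ L | p l ∈ T})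
      (j + 2 * T.card) ≤ minorIdeal M (Set.range f) (Set.range f) j := by
  classical
  induction T using Finset.induction_on with
  | empty => simp
  | insert s T hsT ih =>
    have hs : s ∈ S := hT (Finset.mem_insert_self s T)
    have hTS : T ⊆ S := (Finset.subset_insert s T).trans hT
    refine le_trans ?_ (ih hTS)
    obtain ⟨g, hg⟩ := h.exists_three s hs
    obtain ⟨hgL, hgp⟩ := hg 0
    set Q : Set V := Set.range f ∪ T ∪ {l ∈ L | p l ∈ T} with hQ
    set K : Set V := {l ∈ L | p l = s} \ {g 0} with hK
    have hsQ : s ∉ Q := by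
      rintro ((h' | h') | h')
      · exact ((h.mem_range_iff s).1 h').1 hs
      · exact hsT h'
      · exact h.notMem_of_mem s hs h'.1
    have hsK : s ∉ K := fun h' => h.notMem_of_mem s hs h'.1.1
    have hsg : s ≠ g 0 := fun e => h.notMem_of_mem s hs (e ▸ hgL)
    have hsub : Set.range f ∪ ((insert s T : Finset V) : Set V) ∪
        {l ∈ L | p l ∈ insert s T} ⊆ insert (g 0) (insert s (Q ∪ K)) := by
      rintro v ((hv | hv) | ⟨hv, hvp⟩)
      · exact Or.inr (Or.inr (Or.inl (Or.inl (Or.inl hv))))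
      · rcases Finset.mem_insert.1 hv with rfl | hv
        · exact Or.inr (Or.inl rfl)
        · exact Or.inr (Or.inr (Or.inl (Or.inl (Or.inr hv))))
      · rcases Finset.mem_insert.1 hvp with hvp | hvp
        · by_cases hvg : v = g 0
          · exact Or.inl hvg
          · exact Or.inr (Or.inr (Or.inr ⟨⟨hv, hvp⟩, hvg⟩))
        · exact Or.inr (Or.inr (Or.inl (Or.inr ⟨hv, hvp⟩)))
    rw [Finset.card_insert_of_notMem hsT, mul_add, ← add_assoc]
    refine (minorIdeal_mono M _ hsub (hsub.trans (Set.insert_comm _ _ _).subset)).trans ?_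
    have hne : ∀ v ∈ Q ∪ K, v ≠ s := by
      rintro v (hv | hv) rfl
      · exact hsQ hv
      · exact hsK hv
    refine (minorIdeal_insert_le_of_row (j + 2 * T.card + 1) s ?_).trans ?_
    · rintro v (rfl | hv)
      · exact hrow _ hgL _ (by rw [hgp]; exact hsg.symm)
      · exact hrow _ hgL _ (by rw [hgp]; exact hne v hv)
    refine (minorIdeal_insert_le_of_col (j + 2 * T.card) s ?_).trans ?_
    · exact fun v hv => hcol _ hgL _ (by rw [hgp]; exact hne v hv)
    refine (minorIdeal_union_le_of_rows _ ?_).trans (minorIdeal_union_le_of_cols _ ?_)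
    · exact fun l hl v hv => hrow l hl.1.1 v (by rw [hl.1.2]; exact hne v hv)
    · exact fun l hl v hv => hcol l hl.1.1 v (by rw [hl.1.2]; exact hne v (Or.inl hv))

/-- Modulo the variables of the pendant vertices, the pendant stars split off blocks of rank two. -/
lemma criticalIdeal_le (h : IsStarExtension f S L p) (j : ℕ) :
    criticalIdeal G (j + 2 * S.card) ≤
      Ideal.span {q | ∃ v, v ∈ L ∧ q = MvPolynomial.X v} ⊔
        (criticalIdeal H j).map (MvPolynomial.rename f) := by
  classical
  set J : Ideal (MvPolynomial V ℤ) := Ideal.span {q | ∃ v, v ∈ L ∧ q = MvPolynomial.X v} with hJ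
  let φ : MvPolynomial V ℤ →ₐ[ℤ] MvPolynomial V ℤ :=
    MvPolynomial.aeval fun v => if v ∈ L then 0 else MvPolynomial.X v
  have hφX : ∀ v, φ (MvPolynomial.X v) = if v ∈ L then 0 else MvPolynomial.X v :=
    fun v => MvPolynomial.aeval_X _ _
  have hφ : ∀ q, q - φ q ∈ J := by
    intro q
    rw [← Ideal.Quotient.mk_eq_mk_iff_sub_mem]
    have : (Ideal.Quotient.mk J) = (Ideal.Quotient.mk J).comp φ.toRingHom := by
      refine MvPolynomial.ringHom_ext (fun r => by simp) fun v => ?_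
      change _ = Ideal.Quotient.mk J (φ (MvPolynomial.X v))
      rw [hφX]
      split_ifs with hv
      · rw [map_zero, Ideal.Quotient.eq_zero_iff_mem]
        exact Ideal.subset_span ⟨v, hv, rfl⟩
      · rfl
    exact congrArg (fun ψ : MvPolynomial V ℤ →+* _ => ψ q) this
  have hφf : ∀ q : MvPolynomial W ℤ,
      φ (MvPolynomial.rename f q) = MvPolynomial.rename f q := by
    intro q
    have : φ.comp (MvPolynomial.rename f) = MvPolynomial.rename f := by
      refine MvPolynomial.algHom_ext fun w => ?_
      rw [AlgHom.comp_apply, MvPolynomial.rename_X, hφX,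
        if_neg ((h.mem_range_iff (f w)).1 ⟨w, rfl⟩).2]
    exact congrArg (fun ψ : MvPolynomial W ℤ →ₐ[ℤ] _ => ψ q) this
  have hrow : ∀ l ∈ L, ∀ v, v ≠ p l →
      (genLaplacian G).map (φ : MvPolynomial V ℤ →+* MvPolynomial V ℤ) l v = 0 := by
    intro l hl v hv
    rw [Matrix.map_apply]
    by_cases hvl : v = l
    · subst hvl
      simpa [genLaplacian_self, hφX] using hl
    · rw [h.row_eq_zero hl hvl hv, map_zero]
  have hcol : ∀ l ∈ L, ∀ v, v ≠ p l →
      (genLaplacian G).map (φ : MvPolynomial V ℤ →+* MvPolynomial V ℤ) v l = 0 := by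
    intro l hl v hv
    rw [Matrix.map_apply]
    by_cases hvl : v = l
    · subst hvl
      simpa [genLaplacian_self, hφX] using hl
    · rw [h.col_eq_zero hl hvl hv, map_zero]
  have huniv : Set.univ ⊆ Set.range f ∪ S ∪ {l ∈ L | p l ∈ S} := by
    intro v _
    by_cases hS : v ∈ S
    · exact Or.inl (Or.inr hS)
    · by_cases hL : v ∈ L
      · exact Or.inr ⟨hL, h.parent_mem v hL⟩
      · exact Or.inl (Or.inl ((h.mem_range_iff v).2 ⟨hS, hL⟩))
  intro q hq
  rw [← sub_add_cancel q (φ q)]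
  refine Submodule.add_mem_sup (hφ q) ?_
  have h1 : φ q ∈ (criticalIdeal G (j + 2 * S.card)).map
      (φ : MvPolynomial V ℤ →+* MvPolynomial V ℤ) := Ideal.mem_map_of_mem _ hq
  rw [criticalIdeal_eq_minorIdeal, map_minorIdeal] at h1
  have h2 := h.minorIdeal_le_of_pendant_zero hrow hcol j S subset_rfl
    (minorIdeal_mono _ _ huniv huniv h1)
  rw [← map_minorIdeal, ← map_criticalIdeal_embedding] at h2
  refine (Ideal.map_le_iff_le_comap.2 (Ideal.map_le_iff_le_comap.2 fun x hx => ?_)) h2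
  rw [Ideal.mem_comap, Ideal.mem_comap, AlgHom.coe_toRingHom, hφf]
  exact Ideal.mem_map_of_mem _ hx

lemma criticalIdeal_eq (h : IsStarExtension f S L p) {j : ℕ} (hj : criticalIdeal H j = ⊤) :
    criticalIdeal G (j + 2 * S.card + 1) =
      Ideal.span {q | ∃ v, v ∈ L ∧ q = MvPolynomial.X v} ⊔
        (criticalIdeal H (j + 1)).map (MvPolynomial.rename f) := by
  rw [add_right_comm]
  refine le_antisymm (h.criticalIdeal_le (j + 1)) (sup_le (Ideal.span_le.2 ?_)
    (h.map_criticalIdeal_le (j + 1)))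
  rintro _ ⟨v, hv, rfl⟩
  exact h.X_mem_criticalIdeal hj hv

end IsStarExtension

end PendantStars

/-! ### The 2-matching number -/

section TwoMatching

variable {V W : Type*}

lemma IsTwoMatching.card_le [Fintype V] {G : SimpleGraph V} {M : Finset (Sym2 V)}
    (hM : IsTwoMatching G M) : M.card ≤ twoMatchingNumber G := by
  classical
  unfold twoMatchingNumber
  exact Finset.le_sup (f := Finset.card) (by simpa using hM)

lemma exists_isTwoMatching_card_eq [Fintype V] (G : SimpleGraph V) :
    ∃ M : Finset (Sym2 V), IsTwoMatching G M ∧ M.card = twoMatchingNumber G := by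
  classical
  unfold twoMatchingNumber
  obtain ⟨M, hM, h⟩ := Finset.exists_mem_eq_sup
    (Finset.univ.filter fun M : Finset (Sym2 V) => IsTwoMatching G M)
    ⟨∅, Finset.mem_filter.2 ⟨Finset.mem_univ _, by simp [IsTwoMatching]⟩⟩ Finset.card
  exact ⟨M, by simpa using hM, by convert h.symm⟩

lemma isTwoMatching_iff [DecidableEq V] {G : SimpleGraph V} {M : Finset (Sym2 V)} :
    IsTwoMatching G M ↔
      (∀ e ∈ M, e ∈ G.edgeSet) ∧ ∀ v : V, (M.filter fun e => v ∈ e).card ≤ 2 := by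
  have : ∀ v : V, {e | e ∈ M ∧ v ∈ e}.ncard = (M.filter fun e => v ∈ e).card := by
    intro v
    rw [← Set.ncard_coe_finset]
    congr 1
    ext e
    simp
  simp only [IsTwoMatching, this]

variable {G : SimpleGraph V} {H : SimpleGraph W} {f : H ↪g G}
  {S : Finset V} {L : Set V} {p : V → V}

namespace IsStarExtension

/-- A 2-matching has at most two edges at each centre, and its other edges lie in `H`. -/
lemma twoMatchingNumber_le [Fintype V] [Fintype W] (h : IsStarExtension f S L p) :
    twoMatchingNumber G ≤ twoMatchingNumber H + 2 * S.card := by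
  classical
  obtain ⟨M, hM, hcard⟩ := exists_isTwoMatching_card_eq G
  obtain ⟨hMe, hMv⟩ := isTwoMatching_iff.1 hM
  set N : Finset (Sym2 W) := Finset.univ.filter fun e => Sym2.map f e ∈ M with hN
  have hinj : Function.Injective (Sym2.map f) := Sym2.map.injective f.injective
  have hNM : IsTwoMatching H N := by
    refine isTwoMatching_iff.2 ⟨fun e he => ?_, fun w => ?_⟩
    · have := hMe _ (Finset.mem_filter.1 he).2
      induction e with
      | _ x y => simpa using this
    · refine le_trans ?_ (hMv (f w))
      refine Finset.card_le_card_of_injOn (Sym2.map f) (fun e he => ?_) hinj.injOn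
      simp only [hN, Finset.coe_filter, Finset.mem_filter, Finset.mem_univ, true_and,
        Set.mem_ofPred_eq] at he ⊢
      exact ⟨he.1, Sym2.mem_map.2 ⟨w, he.2, rfl⟩⟩
  have hsub : M ⊆ N.image (Sym2.map f) ∪ S.biUnion fun s => M.filter fun e => s ∈ e := by
    intro e he
    by_cases hs : ∃ s ∈ S, s ∈ e
    · obtain ⟨s, hs, hse⟩ := hs
      exact Finset.mem_union_right _ (Finset.mem_biUnion.2 ⟨s, hs, by simp [he, hse]⟩)
    · push Not at hs
      refine Finset.mem_union_left _ (Finset.mem_image.2 ?_)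
      have hadj := hMe e he
      induction e with
      | _ x y =>
        have hxy : G.Adj x y := by simpa using hadj
        have hx : x ∈ Set.range f := (h.mem_range_iff x).2
          ⟨fun hx => hs x hx (by simp), fun hx => hs y
            (by rw [(h.adj_iff x hx y).1 hxy]; exact h.parent_mem x hx) (by simp)⟩
        have hy : y ∈ Set.range f := (h.mem_range_iff y).2
          ⟨fun hy => hs y hy (by simp), fun hy => hs x
            (by rw [(h.adj_symm_iff hy x).1 hxy]; exact h.parent_mem y hy) (by simp)⟩
        obtain ⟨u, rfl⟩ := hx
        obtain ⟨v, rfl⟩ := hy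
        exact ⟨s(u, v), by simpa [hN] using he, by simp⟩
  calc twoMatchingNumber G = M.card := hcard.symm
    _ ≤ _ := Finset.card_le_card hsub
    _ ≤ _ := Finset.card_union_le _ _
    _ ≤ N.card + 2 * S.card := by
        refine add_le_add Finset.card_image_le ?_
        rw [mul_comm]
        exact Finset.card_biUnion_le_card_mul _ _ _ fun s _ => hMv s
    _ ≤ _ := Nat.add_le_add_right hNM.card_le _

/-- A 2-matching of `H` together with two pendant edges at each centre is a 2-matching. -/
lemma le_twoMatchingNumber [Fintype V] [Fintype W] (h : IsStarExtension f S L p) :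
    twoMatchingNumber H + 2 * S.card ≤ twoMatchingNumber G := by
  classical
  obtain ⟨a, b, hab⟩ := h.exists_pair
  obtain ⟨N, hN, hcard⟩ := exists_isTwoMatching_card_eq H
  obtain ⟨hNe, hNv⟩ := isTwoMatching_iff.1 hN
  have hinj : Function.Injective (Sym2.map f) := Sym2.map.injective f.injective
  have hfS : ∀ w, f w ∉ S := fun w => ((h.mem_range_iff (f w)).1 ⟨w, rfl⟩).1
  have hfL : ∀ w, f w ∉ L := fun w => ((h.mem_range_iff (f w)).1 ⟨w, rfl⟩).2
  have eq_of_mk_eq : ∀ x y s t, s ∈ S → t ∈ S → x ∈ L → y ∈ L → s(s, x) = s(t, y) →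
      s = t ∧ x = y := by
    intro x y s t hs ht hx hy hst
    rcases Sym2.eq_iff.1 hst with h' | h'
    · exact h'
    · exact absurd hy (h'.1 ▸ h.notMem_of_mem s hs)
  -- One pendant edge at each centre.
  let E : (V → V) → Finset (Sym2 V) := fun g => S.image fun s => s(s, g s)
  have hE : ∀ g : V → V, (∀ s ∈ S, g s ∈ L ∧ p (g s) = s) →
      (∀ e ∈ E g, e ∈ G.edgeSet) ∧ (E g).card = S.card ∧
      (∀ w, ∀ e ∈ E g, f w ∉ e) ∧ ∀ v, ((E g).filter fun e => v ∈ e).card ≤ 1 := by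
    intro g hg
    refine ⟨fun e he => ?_, Finset.card_image_of_injOn fun s hs t ht hst => ?_,
      fun w e he hw => ?_, fun v => Finset.card_le_one.2 fun e he e' he' => ?_⟩
    · obtain ⟨s, hs, rfl⟩ := Finset.mem_image.1 he
      exact (h.adj_symm_iff (hg s hs).1 s).2 (hg s hs).2.symm
    · exact (eq_of_mk_eq _ _ _ _ hs ht (hg s hs).1 (hg t ht).1 hst).1
    · obtain ⟨s, hs, rfl⟩ := Finset.mem_image.1 he
      rcases Sym2.mem_iff.1 hw with hw | hw
      · exact hfS w (hw ▸ hs)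
      · exact hfL w (hw ▸ (hg s hs).1)
    · obtain ⟨he, hv⟩ := Finset.mem_filter.1 he
      obtain ⟨he', hv'⟩ := Finset.mem_filter.1 he'
      obtain ⟨s, hs, rfl⟩ := Finset.mem_image.1 he
      obtain ⟨t, ht, rfl⟩ := Finset.mem_image.1 he'
      have hst : s = t := by
        rcases Sym2.mem_iff.1 hv with rfl | rfl <;> rcases Sym2.mem_iff.1 hv' with hv' | hv'
        · exact hv'
        · exact absurd (hg t ht).1 (hv' ▸ h.notMem_of_mem _ hs)
        · exact absurd (hg s hs).1 (hv' ▸ h.notMem_of_mem _ ht)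
        · rw [← (hg s hs).2, hv', (hg t ht).2]
      rw [hst]
  obtain ⟨haG, hacard, haf, hav⟩ := hE a fun s hs => (hab s hs).1
  obtain ⟨hbG, hbcard, hbf, hbv⟩ := hE b fun s hs => (hab s hs).2.1
  have hdab : Disjoint (E a) (E b) := by
    refine Finset.disjoint_left.2 fun e hea heb => ?_
    obtain ⟨s, hs, rfl⟩ := Finset.mem_image.1 hea
    obtain ⟨t, ht, hst⟩ := Finset.mem_image.1 heb
    obtain ⟨rfl, hb⟩ := eq_of_mk_eq _ _ _ _ ht hs (hab t ht).2.1.1 (hab s hs).1.1 hst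
    exact (hab t ht).2.2 hb.symm
  have hdN : Disjoint (N.image (Sym2.map f)) (E a ∪ E b) := by
    refine Finset.disjoint_left.2 fun e heN he => ?_
    obtain ⟨e, -, rfl⟩ := Finset.mem_image.1 heN
    induction e with
    | _ x y =>
      rcases Finset.mem_union.1 he with he | he
      · exact haf x _ he (by simp)
      · exact hbf x _ he (by simp)
  have hM : IsTwoMatching G (N.image (Sym2.map f) ∪ (E a ∪ E b)) := by
    refine isTwoMatching_iff.2 ⟨fun e he => ?_, fun v => ?_⟩
    · rcases Finset.mem_union.1 he with he | he
      · obtain ⟨e, heN, rfl⟩ := Finset.mem_image.1 he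
        have := hNe e heN
        induction e with
        | _ x y => simpa using this
      · rcases Finset.mem_union.1 he with he | he
        · exact haG e he
        · exact hbG e he
    · rw [Finset.filter_union, Finset.filter_union]
      by_cases hv : ∃ w, f w = v
      · obtain ⟨w, rfl⟩ := hv
        rw [Finset.filter_false_of_mem (haf w), Finset.filter_false_of_mem (hbf w),
          Finset.empty_union, Finset.union_empty, Finset.filter_image]
        refine Finset.card_image_le.trans (le_trans (Finset.card_le_card ?_) (hNv w))
        intro e he
        obtain ⟨he, hw⟩ := Finset.mem_filter.1 he
        obtain ⟨u, hu, huw⟩ := Sym2.mem_map.1 hw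
        exact Finset.mem_filter.2 ⟨he, f.injective huw ▸ hu⟩
      · rw [Finset.filter_false_of_mem (s := N.image (Sym2.map f)), Finset.empty_union]
        · exact (Finset.card_union_le _ _).trans (add_le_add (hav v) (hbv v))
        · intro e he hve
          obtain ⟨e, -, rfl⟩ := Finset.mem_image.1 he
          obtain ⟨u, -, huv⟩ := Sym2.mem_map.1 hve
          exact hv ⟨u, huv⟩
  refine le_trans (le_of_eq ?_) hM.card_le
  rw [Finset.card_union_of_disjoint hdN, Finset.card_union_of_disjoint hdab, hacard, hbcard,
    Finset.card_image_of_injective _ hinj, hcard, two_mul]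

lemma twoMatchingNumber_eq [Fintype V] [Fintype W] (h : IsStarExtension f S L p) :
    twoMatchingNumber G = twoMatchingNumber H + 2 * S.card :=
  le_antisymm h.twoMatchingNumber_le h.le_twoMatchingNumber

end IsStarExtension

end TwoMatching

/-! ### The first nontrivial critical ideal -/

section FirstNontrivial

variable {V W : Type*}

lemma twoMatchingNumber_bot [Fintype V] : twoMatchingNumber (⊥ : SimpleGraph V) = 0 := by
  obtain ⟨M, hM, hcard⟩ := exists_isTwoMatching_card_eq (⊥ : SimpleGraph V)
  rw [← hcard, Finset.card_eq_zero, Finset.eq_empty_iff_forall_notMem]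
  intro e he
  simpa using hM.1 e he

/-- The critical ideal of index `ν₂(G)`, hence every one before it, is trivial, and the next one is
contained in the ideal of polynomials without constant term. Unlike mere properness, the latter
condition passes to star extensions by inspection of generators. -/
def NontrivialAfterTwoMatchings [Fintype V] (G : SimpleGraph V) : Prop :=
  criticalIdeal G (twoMatchingNumber G) = ⊤ ∧
    criticalIdeal G (twoMatchingNumber G + 1) ≤
      RingHom.ker (MvPolynomial.constantCoeff : MvPolynomial V ℤ →+* ℤ)

lemma nontrivialAfterTwoMatchings_bot [Fintype V] :
    NontrivialAfterTwoMatchings (⊥ : SimpleGraph V) := by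
  rw [NontrivialAfterTwoMatchings, twoMatchingNumber_bot]
  refine ⟨criticalIdeal_zero _, ?_⟩
  rw [criticalIdeal_eq_minorIdeal]
  refine minorIdeal_le fun r c _ _ _ _ => RingHom.mem_ker.2 ?_
  rw [Matrix.det_fin_one, Matrix.submatrix_apply]
  by_cases h : r 0 = c 0
  · rw [h, genLaplacian_self, MvPolynomial.constantCoeff_X]
  · rw [genLaplacian_of_not_adj h (by simp), map_zero]

lemma IsStarExtension.nontrivialAfterTwoMatchings [Fintype V] [Fintype W] {G : SimpleGraph V}
    {H : SimpleGraph W} {f : H ↪g G} {S : Finset V} {L : Set V} {p : V → V}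
    (h : IsStarExtension f S L p) (hH : NontrivialAfterTwoMatchings H) :
    NontrivialAfterTwoMatchings G := by
  refine ⟨?_, ?_⟩
  · rw [h.twoMatchingNumber_eq, eq_top_iff]
    refine le_trans ?_ (h.map_criticalIdeal_le _)
    rw [hH.1, Ideal.map_top]
  · rw [h.twoMatchingNumber_eq, h.criticalIdeal_eq hH.1]
    refine sup_le (Ideal.span_le.2 ?_) (Ideal.map_le_iff_le_comap.2 fun x hx => ?_)
    · rintro _ ⟨v, -, rfl⟩
      exact MvPolynomial.constantCoeff_X _ v
    · rw [Ideal.mem_comap, RingHom.mem_ker, MvPolynomial.constantCoeff_rename]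
      exact hH.2 hx

/-- A `j`-minor exists only if `j` is at most the number of vertices. -/
lemma le_card_of_criticalIdeal_ne_bot [Fintype V] {G : SimpleGraph V} {j : ℕ}
    (h : criticalIdeal G j ≠ ⊥) : j ≤ Fintype.card V := by
  by_contra hj
  refine h (Ideal.span_eq_bot.2 ?_)
  rintro _ ⟨r, -, -⟩
  exact absurd (Fintype.card_le_of_embedding r) (by simpa using hj)

lemma NontrivialAfterTwoMatchings.isLeast [Fintype V] {G : SimpleGraph V}
    (hG : NontrivialAfterTwoMatchings G) (h : criticalIdeal G (twoMatchingNumber G + 1) ≠ ⊥) :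
    IsLeast {j : ℕ | 1 ≤ j ∧ j ≤ Fintype.card V ∧ criticalIdeal G j ≠ ⊤}
      (twoMatchingNumber G + 1) := by
  refine ⟨⟨Nat.le_add_left _ _, le_card_of_criticalIdeal_ne_bot h, fun htop => ?_⟩, ?_⟩
  · have h1 := hG.2 (htop ▸ Submodule.mem_top : (1 : MvPolynomial V ℤ) ∈ _)
    rw [RingHom.mem_ker, map_one] at h1
    exact one_ne_zero h1
  · rintro j ⟨-, -, hj⟩
    by_contra hlt
    refine hj (eq_top_iff.2 (hG.1.ge.trans (criticalIdeal_antitone G ?_)))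
    omega

end FirstNontrivial

/-! ### Trees whose branching depends only on the depth -/

section Trees

variable {b : ℕ → ℕ} {h m : ℕ}

lemma TreeVertex.ext_of_letters {u v : TreeVertex b h} (hd : (u.1 : ℕ) = v.1)
    (hw : ∀ j (hu : j < (u.1 : ℕ)) (hv : j < (v.1 : ℕ)), u.2 ⟨j, hu⟩ = v.2 ⟨j, hv⟩) : u = v := by
  obtain ⟨i, u⟩ := u
  obtain ⟨i', v⟩ := v
  obtain rfl : i = i' := Fin.ext hd
  congr 1
  funext j
  exact hw j j.2 j.2

/-- The parent of a vertex: its word without the last letter. The root is its own parent. -/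
def TreeVertex.parent (v : TreeVertex b h) : TreeVertex b h :=
  ⟨⟨(v.1 : ℕ) - 1, by omega⟩, fun j => v.2 ⟨j, by have := j.2; simp only at this; omega⟩⟩

lemma isChild_iff {v u : TreeVertex b h} : IsChild v u ↔ 1 ≤ (u.1 : ℕ) ∧ v = u.parent := by
  constructor
  · rintro ⟨hl, hw⟩
    refine ⟨by omega, TreeVertex.ext_of_letters (by simp [TreeVertex.parent, hl]) ?_⟩
    intro j hv hu
    exact (hw ⟨j, hv⟩).symm
  · rintro ⟨hu, rfl⟩
    exact ⟨by simp only [TreeVertex.parent]; omega, fun j => rfl⟩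

/-- The child of `v` obtained by appending the letter `a`. -/
def TreeVertex.child (v : TreeVertex b h) (hv : (v.1 : ℕ) < h) (a : Fin (b v.1)) :
    TreeVertex b h :=
  ⟨⟨(v.1 : ℕ) + 1, by omega⟩, fun j =>
    if hj : (j : ℕ) < v.1 then v.2 ⟨j, hj⟩
    else Fin.cast (by congr 1; have := j.2; simp only at this; omega) a⟩

lemma isChild_child (v : TreeVertex b h) (hv : (v.1 : ℕ) < h) (a : Fin (b v.1)) :
    IsChild v (v.child hv a) :=
  ⟨rfl, fun j => by simp [TreeVertex.child]⟩

lemma child_injective (v : TreeVertex b h) (hv : (v.1 : ℕ) < h) :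
    Function.Injective (v.child hv) := by
  intro a a' haa
  have h1 := eq_of_heq (Sigma.mk.inj haa).2
  have h2 := congrFun h1 ⟨v.1, Nat.lt_succ_self _⟩
  simpa using h2

lemma branchingTree_adj_iff {u v : TreeVertex b h} :
    (branchingTree b h).Adj u v ↔ IsChild u v ∨ IsChild v u := Iff.rfl

lemma branchingTree_adj_iff_of_depth_eq {u : TreeVertex b h} (hh : 1 ≤ h) (hu : (u.1 : ℕ) = h)
    (v : TreeVertex b h) : (branchingTree b h).Adj u v ↔ v = u.parent := by
  rw [branchingTree_adj_iff, isChild_iff (v := v)]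
  constructor
  · rintro (⟨hl, -⟩ | ⟨-, h'⟩)
    · omega
    · exact h'
  · exact fun h' => Or.inr ⟨by omega, h'⟩

lemma isLeaf_branchingTree_iff (hb : ∀ i, 2 ≤ b i) (hh : 1 ≤ h) (v : TreeVertex b h) :
    IsLeaf (branchingTree b h) v ↔ (v.1 : ℕ) = h := by
  rw [IsLeaf, Set.ncard_eq_one]
  constructor
  · rintro ⟨w, hw⟩
    by_contra hne
    have hv : (v.1 : ℕ) < h := by omega
    have key : ∀ a, v.child hv a = w := fun a => by
      rw [← Set.mem_singleton_iff, ← hw]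
      exact Or.inl (isChild_child v hv a)
    have := child_injective v hv ((key ⟨0, by have := hb v.1; omega⟩).trans
      (key ⟨1, hb v.1⟩).symm)
    simp at this
  · intro hv
    refine ⟨v.parent, Set.ext fun u => ?_⟩
    rw [SimpleGraph.mem_neighborSet, branchingTree_adj_iff_of_depth_eq hh hv,
      Set.mem_singleton_iff]

lemma isStarExtension_of_mem_range_iff {W : Type*} {H : SimpleGraph W}
    (f : H ↪g branchingTree b h) (hb : ∀ i, 3 ≤ b i) (hh : 1 ≤ h)
    (hf : ∀ v : TreeVertex b h, v ∈ Set.range f ↔ (v.1 : ℕ) + 1 < h) :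
    IsStarExtension f (Finset.univ.filter fun v : TreeVertex b h => (v.1 : ℕ) + 1 = h)
      {v | (v.1 : ℕ) = h} TreeVertex.parent where
  mem_range_iff v := by
    rw [hf, Finset.mem_filter, Set.mem_ofPred_eq]
    have := v.1.2
    simp only [Finset.mem_univ, true_and]
    omega
  notMem_of_mem v hv := by
    rw [Finset.mem_filter] at hv
    rw [Set.mem_ofPred_eq]
    omega
  parent_mem l hl := by
    rw [Set.mem_ofPred_eq] at hl
    simp only [Finset.mem_filter, Finset.mem_univ, true_and, TreeVertex.parent]
    omega
  adj_iff l hl v := branchingTree_adj_iff_of_depth_eq hh hl v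
  exists_three s hs := by
    have hs' : (s.1 : ℕ) + 1 = h := (Finset.mem_filter.1 hs).2
    have hlt : (s.1 : ℕ) < h := by omega
    refine ⟨(Fin.castLEEmb (hb s.1)).trans ⟨s.child hlt, child_injective s hlt⟩, fun i => ⟨hs', ?_⟩⟩
    exact (isChild_iff.1 (isChild_child s hlt _)).2.symm

lemma isStarExtension_rootedCopy (hb : ∀ i, 3 ≤ b i) (hm : m ≤ h) (hmh : m + 2 = h) :
    IsStarExtension (rootedCopy b hm)
      (Finset.univ.filter fun v : TreeVertex b h => (v.1 : ℕ) + 1 = h)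
      {v | (v.1 : ℕ) = h} TreeVertex.parent := by
  refine isStarExtension_of_mem_range_iff _ hb (by omega) fun v => ⟨?_, fun hv => ?_⟩
  · rintro ⟨w, rfl⟩
    have : (((rootedCopy b hm) w).1 : ℕ) = w.1 := rfl
    omega
  · exact ⟨⟨⟨v.1, by omega⟩, v.2⟩, rfl⟩

/-- The tree of depth one is obtained from the empty graph by adding a star, so both parities of the
depth start from an edgeless graph. -/
lemma nontrivialAfterTwoMatchings_branchingTree (hb : ∀ i, 3 ≤ b i) :
    ∀ h, NontrivialAfterTwoMatchings (branchingTree b h)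
  | 0 => by
    have : branchingTree b 0 = ⊥ := by
      ext u v
      rw [branchingTree_adj_iff, SimpleGraph.bot_adj, iff_false]
      rintro (⟨hl, -⟩ | ⟨hl, -⟩) <;> omega
    rw [this]
    exact nontrivialAfterTwoMatchings_bot
  | 1 => by
    let f : (⊥ : SimpleGraph Empty) ↪g branchingTree b 1 :=
      ⟨Function.Embedding.ofIsEmpty, fun {u} => u.elim⟩
    refine (isStarExtension_of_mem_range_iff f hb le_rfl fun v => ?_).nontrivialAfterTwoMatchings
      nontrivialAfterTwoMatchings_bot
    simp
  | h + 2 => (isStarExtension_rootedCopy hb (Nat.le_add_right h 2) rfl).nontrivialAfterTwoMatchings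
      (nontrivialAfterTwoMatchings_branchingTree hb h)

theorem isLeast_and_criticalIdeal_branchingTree (hb : ∀ i, 3 ≤ b i) (hh : 2 ≤ h) :
    IsLeast {j : ℕ | 1 ≤ j ∧ j ≤ Fintype.card (TreeVertex b h) ∧
          criticalIdeal (branchingTree b h) j ≠ ⊤}
        (twoMatchingNumber (branchingTree b h) + 1) ∧
      criticalIdeal (branchingTree b h) (twoMatchingNumber (branchingTree b h) + 1) =
        Ideal.span {p | ∃ v, IsLeaf (branchingTree b h) v ∧ p = MvPolynomial.X v} ⊔
          Ideal.map (MvPolynomial.rename (rootedCopy b (Nat.sub_le h 2)))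
            (criticalIdeal (branchingTree b (h - 2))
              (twoMatchingNumber (branchingTree b (h - 2)) + 1)) := by
  have hstar := isStarExtension_rootedCopy hb (Nat.sub_le h 2) (by omega)
  have hsub := nontrivialAfterTwoMatchings_branchingTree hb (h - 2)
  have heq : criticalIdeal (branchingTree b h) (twoMatchingNumber (branchingTree b h) + 1) =
      Ideal.span {p | ∃ v, IsLeaf (branchingTree b h) v ∧ p = MvPolynomial.X v} ⊔
        Ideal.map (MvPolynomial.rename (rootedCopy b (Nat.sub_le h 2)))
          (criticalIdeal (branchingTree b (h - 2))
            (twoMatchingNumber (branchingTree b (h - 2)) + 1)) := by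
    rw [hstar.twoMatchingNumber_eq, hstar.criticalIdeal_eq hsub.1]
    simp only [isLeaf_branchingTree_iff (fun i => (by have := hb i; omega : 2 ≤ b i))
      (by omega : 1 ≤ h), Set.mem_ofPred_eq]
  refine ⟨(hstar.nontrivialAfterTwoMatchings hsub).isLeast fun hbot => ?_, heq⟩
  -- The variable of a leaf is a nonzero element.
  let v : TreeVertex b h := ⟨Fin.last h, fun j => ⟨0, by have := hb j; omega⟩⟩
  have hv : MvPolynomial.X v ∈ criticalIdeal (branchingTree b h)
      (twoMatchingNumber (branchingTree b h) + 1) := by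
    rw [heq]
    exact Ideal.mem_sup_left (Ideal.subset_span
      ⟨v, (isLeaf_branchingTree_iff (fun i => by have := hb i; omega) (by omega) v).2 rfl, rfl⟩)
  rw [hbot] at hv
  exact MvPolynomial.X_ne_zero v (Ideal.mem_bot.1 hv)

end Trees

theorem corollary5p4 (d h : ℕ) (hd : 4 ≤ d) (hh : 3 ≤ h) :
    (IsLeast {j : ℕ | 1 ≤ j ∧ j ≤ Fintype.card (TreeVertex (fun _ => d - 1) h) ∧
          criticalIdeal (prunedTree d h) j ≠ ⊤}
        (twoMatchingNumber (prunedTree d h) + 1) ∧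
      criticalIdeal (prunedTree d h) (twoMatchingNumber (prunedTree d h) + 1) =
        Ideal.span {p | ∃ v, IsLeaf (prunedTree d h) v ∧ p = MvPolynomial.X v} ⊔
          Ideal.map (MvPolynomial.rename (rootedCopy (fun _ => d - 1) (Nat.sub_le h 2)))
            (criticalIdeal (prunedTree d (h - 2))
              (twoMatchingNumber (prunedTree d (h - 2)) + 1))) ∧
    (IsLeast {j : ℕ | 1 ≤ j ∧ j ≤ Fintype.card (TreeVertex (regularBranching d) h) ∧
          criticalIdeal (regularTree d h) j ≠ ⊤}
        (twoMatchingNumber (regularTree d h) + 1) ∧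
      criticalIdeal (regularTree d h) (twoMatchingNumber (regularTree d h) + 1) =
        Ideal.span {p | ∃ v, IsLeaf (regularTree d h) v ∧ p = MvPolynomial.X v} ⊔
          Ideal.map (MvPolynomial.rename (rootedCopy (regularBranching d) (Nat.sub_le h 2)))
            (criticalIdeal (regularTree d (h - 2))
              (twoMatchingNumber (regularTree d (h - 2)) + 1))) := by
  refine ⟨isLeast_and_criticalIdeal_branchingTree (fun _ => by omega) (by omega),
    isLeast_and_criticalIdeal_branchingTree (fun i => ?_) (by omega)⟩
  unfold regularBranching
  split_ifs <;> omega
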